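/- Theorem (Approximate Posterior Mean of Nyström (SoR, DTC) and SVGP). \label{thm:itergp-nystroem} Let $\mathcal{X}$ be a set (e.g. $\mathcal{X}\subseteq\mathbb{R}^d$), $\mu:\mathcal{X}\to\mathbb{R}$ a prior mean function and $k:\mathcal{X}\times\mathcal{X}\to\mathbb{R}$ a symmetric positive semidefinite kernel. Let $X=(x_1,\dots,x_n)$ be training inputs with observations $y\in\mathbb{R}^n$ and likelihood $p(y\mid f(X))=\mathcal{N}(y;f(X),\sigma^2 I)$, $\sigma>0$. For tuples $A,B$ of points write $K_{AB}=k(A,B)$ for the kernel matrix and $\mu_A=\mu(A)$, and put $\boldsymbol\mu=\mu_X$. Let $Z=(z_1,\dots,z_m)$ be inducing inputs with $\operatorname{rank}(K_{XZ})=m$ (so that $m\le n$ and the $z_j$ are distinct), and let $q(\cdot,\cdot)=k(\cdot,Z)K_{ZZ}^{-1}k(Z,\cdot)$. Let $p(u)=\mathcal{N}(\mu_Z,K_{ZZ})$ be the prior of $u=f(Z)$ and, for a finite tuple $A$ of points, $p(f(A)\mid u)=\mathcal{N}\big(\mu_A+K_{AZ}K_{ZZ}^{-1}(u-\mu_Z),\,K_{AA}-q(A,A)\big)$.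 The three approximations are defined as follows, for a tuple $A$ of test inputs. (SoR) and (DTC): the joint prior of $(f(X),f(A))$ is replaced by $\int \tilde p(f(X)\mid u)\,\tilde p(f(A)\mid u)\,p(u)\,du$, and the posterior of $f(A)$ is obtained from it and the likelihood by Bayes' rule. In both, $\tilde p(f(X)\mid u)$ is the point mass at $\mu_X+K_{XZ}K_{ZZ}^{-1}(u-\mu_Z)$. For SoR, $\tilde p(f(A)\mid u)$ is the point mass at $\mu_A+K_{AZ}K_{ZZ}^{-1}(u-\mu_Z)$; for DTC, $\tilde p(f(A)\mid u)=p(f(A)\mid u)$. (SVGP): the posterior of $f(A)$ is $\int p(f(A)\mid u)\,q(u)\,du$, where $q(u)=\mathcal{N}(a,S)$ maximizes the evidence lower bound $\mathbb{E}_{q(f(X))}[\log p(y\mid f(X))]-\mathrm{KL}(q(u)\,\|\,p(u))$, $q(f(X))=\int p(f(X)\mid u)q(u)\,du$, over all $a\in\mathbb{R}^m$ and all positive semidefinite $S\in\mathbb{R}^{m\times m}$, with $Z$ fixed. Then a maximizer $(a,S)$ with $S$ positive definite exists. The posteriors of SoR and of DTC, and that of SVGP for every maximizer $(a,S)$, are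 probability laws with finite first moment, and their mean functions are all equal to $$\mu(\cdot)+k(\cdot,Z)\,(K_{ZX}K_{XZ}+\sigma^2K_{ZZ})^{-1}K_{ZX}(y-\boldsymbol\mu) =\mu(\cdot)+q(\cdot,X)K_{XZ}\big(K_{ZX}(q(X,X)+\sigma^2 I)K_{XZ}\big)^{-1}K_{ZX}(y-\boldsymbol\mu),$$ where all the matrices that are inverted, including $K_{ZZ}$, are invertible. -/

import Mathlib

open MeasureTheory ProbabilityTheory Matrix
open scoped ENNReal NNReal

noncomputable section

namespace SparseGP

variable {𝒳 : Type*} {m n t : ℕ}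

/-- The kernel matrix `K_AB = k(A, B)`, with entries `k (A i) (B j)`. -/
def gram (k : 𝒳 → 𝒳 → ℝ) (A : Fin n → 𝒳) (B : Fin m → 𝒳) : Matrix (Fin n) (Fin m) ℝ :=
  Matrix.of fun i j => k (A i) (B j)

/-- The vector `k(x, Z) = (k(x, z₁), …, k(x, z_m))`. -/
def kvec (k : 𝒳 → 𝒳 → ℝ) (x : 𝒳) (Z : Fin m → 𝒳) : Fin m → ℝ := fun j => k x (Z j)

/-- The low-rank kernel `q(x, x') = k(x, Z) K_ZZ⁻¹ k(Z, x')`. -/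
def lowRank (k : 𝒳 → 𝒳 → ℝ) (Z : Fin m → 𝒳) : 𝒳 → 𝒳 → ℝ := fun x x' =>
  kvec k x Z ⬝ᵥ ((gram k Z Z)⁻¹ *ᵥ fun j => k (Z j) x')

/-- The Gaussian prior law of the inducing variables `u = f(Z) ∼ 𝒩(μ_Z, K_ZZ)`. -/
def inducingPrior (μ : 𝒳 → ℝ) (k : 𝒳 → 𝒳 → ℝ) (Z : Fin m → 𝒳) :
    Measure (EuclideanSpace ℝ (Fin m)) :=
  multivariateGaussian (WithLp.toLp 2 fun j => μ (Z j)) (gram k Z Z)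

/-- The conditional mean of `f(A)` given `f(Z) = u`, namely
`μ_A + K_AZ K_ZZ⁻¹ (u - μ_Z)`. -/
def condMean (μ : 𝒳 → ℝ) (k : 𝒳 → 𝒳 → ℝ) (Z : Fin m → 𝒳) (A : Fin t → 𝒳)
    (u : EuclideanSpace ℝ (Fin m)) : EuclideanSpace ℝ (Fin t) :=
  WithLp.toLp 2 fun i =>
    μ (A i) + kvec k (A i) Z ⬝ᵥ ((gram k Z Z)⁻¹ *ᵥ fun j => u j - μ (Z j))

lemma measurable_condMean (μ : 𝒳 → ℝ) (k : 𝒳 → 𝒳 → ℝ) (Z : Fin m → 𝒳) (A : Fin t → 𝒳) :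
    Measurable (condMean μ k Z A) := by
  unfold condMean Matrix.mulVec dotProduct
  fun_prop

open scoped MatrixOrder in
lemma measurable_multivariateGaussian (S : Matrix (Fin t) (Fin t) ℝ) :
    Measurable fun a : EuclideanSpace ℝ (Fin t) => multivariateGaussian a S := by
  refine Measure.measurable_of_measurable_coe _ fun s hs => ?_
  have h : Measurable fun p : EuclideanSpace ℝ (Fin t) × EuclideanSpace ℝ (Fin t) =>
      p.1 + toEuclideanCLM (𝕜 := ℝ) (CFC.sqrt S) p.2 := by fun_prop
  have h2 := measurable_measure_prodMk_left
    (ν := stdGaussian (EuclideanSpace ℝ (Fin t))) (h hs)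
  convert h2 using 2 with a
  rw [multivariateGaussian, Measure.map_apply (by fun_prop) hs]
  rfl

/-- The exact Gaussian process conditional `p(f(A) ∣ f(Z) = u)`, namely
`𝒩(μ_A + K_AZ K_ZZ⁻¹ (u - μ_Z), K_AA - K_AZ K_ZZ⁻¹ K_ZA)`. -/
def exactCond (μ : 𝒳 → ℝ) (k : 𝒳 → 𝒳 → ℝ) (Z : Fin m → 𝒳) (A : Fin t → 𝒳) :
    Kernel (EuclideanSpace ℝ (Fin m)) (EuclideanSpace ℝ (Fin t)) where
  toFun u := multivariateGaussian (condMean μ k Z A u) (gram k A A - gram (lowRank k Z) A A)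
  measurable' := (measurable_multivariateGaussian _).comp (measurable_condMean μ k Z A)

instance isMarkovKernel_exactCond (μ : 𝒳 → ℝ) (k : 𝒳 → 𝒳 → ℝ) (Z : Fin m → 𝒳)
    (A : Fin t → 𝒳) : IsMarkovKernel (exactCond μ k Z A) where
  isProbabilityMeasure u := by
    change IsProbabilityMeasure (multivariateGaussian _ _)
    infer_instance

/-- The deterministic conditional: given `f(Z) = u`, the vector `f(A)` is set equal to the
conditional mean `μ_A + K_AZ K_ZZ⁻¹ (u - μ_Z)`, with zero covariance. -/
def detCond (μ : 𝒳 → ℝ) (k : 𝒳 → 𝒳 → ℝ) (Z : Fin m → 𝒳) (A : Fin t → 𝒳) :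
    Kernel (EuclideanSpace ℝ (Fin m)) (EuclideanSpace ℝ (Fin t)) :=
  Kernel.deterministic (condMean μ k Z A) (measurable_condMean μ k Z A)

instance isMarkovKernel_detCond (μ : 𝒳 → ℝ) (k : 𝒳 → 𝒳 → ℝ) (Z : Fin m → 𝒳)
    (A : Fin t → 𝒳) : IsMarkovKernel (detCond μ k Z A) := by
  unfold detCond
  infer_instance

/-- The joint prior of (training values, test values) obtained from an inducing prior `p(u)` and
training and test conditionals under which the two are independent given `u`:
`∫ q(f ∣ u) q(f_* ∣ u) p(u) du`. -/
def jointPrior (p : Measure (EuclideanSpace ℝ (Fin m)))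
    (train : Kernel (EuclideanSpace ℝ (Fin m)) (EuclideanSpace ℝ (Fin n)))
    (test : Kernel (EuclideanSpace ℝ (Fin m)) (EuclideanSpace ℝ (Fin t))) :
    Measure (EuclideanSpace ℝ (Fin n) × EuclideanSpace ℝ (Fin t)) :=
  p.bind (train ×ₖ test)

/-- The likelihood `p(y ∣ f) = 𝒩(y; f, σ² I)` of the observations `y` given training values `f`. -/
def likelihood (σ : ℝ) (y : Fin n → ℝ) (f : EuclideanSpace ℝ (Fin n)) : ℝ :=
  ∏ i, gaussianPDFReal (f i) ⟨σ ^ 2, sq_nonneg σ⟩ (y i)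

/-- Bayes' rule: the posterior law of the test values given `y`, i.e. the second marginal of
`p(y ∣ f) P(df, df_*) / ∫ p(y ∣ f) P(df, df_*)`. -/
def posterior (σ : ℝ) (y : Fin n → ℝ)
    (P : Measure (EuclideanSpace ℝ (Fin n) × EuclideanSpace ℝ (Fin t))) :
    Measure (EuclideanSpace ℝ (Fin t)) :=
  ((∫⁻ z, ENNReal.ofReal (likelihood σ y z.1) ∂P)⁻¹ •
    P.withDensity fun z => ENNReal.ofReal (likelihood σ y z.1)).map Prod.snd

/-- Subset of regressors: training and test conditionals are both deterministic. -/
def sorPosterior (μ : 𝒳 → ℝ) (k : 𝒳 → 𝒳 → ℝ) (Z : Fin m → 𝒳) (σ : ℝ)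
    (X : Fin n → 𝒳) (y : Fin n → ℝ) (A : Fin t → 𝒳) : Measure (EuclideanSpace ℝ (Fin t)) :=
  posterior σ y (jointPrior (inducingPrior μ k Z) (detCond μ k Z X) (detCond μ k Z A))

/-- Deterministic training conditional: the training conditional is deterministic, the test
conditional is exact. -/
def dtcPosterior (μ : 𝒳 → ℝ) (k : 𝒳 → 𝒳 → ℝ) (Z : Fin m → 𝒳) (σ : ℝ)
    (X : Fin n → 𝒳) (y : Fin n → ℝ) (A : Fin t → 𝒳) : Measure (EuclideanSpace ℝ (Fin t)) :=
  posterior σ y (jointPrior (inducingPrior μ k Z) (detCond μ k Z X) (exactCond μ k Z A))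

/-- The SVGP approximate posterior of the values at `A` for the variational distribution
`q(u) = 𝒩(a, S)`, namely `∫ p(f(A) ∣ u) q(u) du`. -/
def svgpPosterior (μ : 𝒳 → ℝ) (k : 𝒳 → 𝒳 → ℝ) (Z : Fin m → 𝒳)
    (a : EuclideanSpace ℝ (Fin m)) (S : Matrix (Fin m) (Fin m) ℝ) (A : Fin t → 𝒳) :
    Measure (EuclideanSpace ℝ (Fin t)) :=
  (multivariateGaussian a S).bind (exactCond μ k Z A)

/-- The evidence lower bound `𝔼_{q(f)} [log p(y ∣ f)] - KL(q(u) ‖ p(u))` of SVGP for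
`q(u) = 𝒩(a, S)`, where `q(f) = ∫ p(f(X) ∣ u) q(u) du`; it is `-∞` if the divergence is `∞`. -/
def elbo (μ : 𝒳 → ℝ) (k : 𝒳 → 𝒳 → ℝ) (Z : Fin m → 𝒳) (σ : ℝ)
    (X : Fin n → 𝒳) (y : Fin n → ℝ)
    (a : EuclideanSpace ℝ (Fin m)) (S : Matrix (Fin m) (Fin m) ℝ) : EReal :=
  ((∫ f, Real.log (likelihood σ y f) ∂(svgpPosterior μ k Z a S X) : ℝ) : EReal) -
    ((InformationTheory.klDiv (multivariateGaussian a S) (inducingPrior μ k Z) : ℝ≥0∞) : EReal)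

/-- `(a, S)` are optimal variational parameters for SVGP with the inducing inputs `Z` fixed: they
maximize the evidence lower bound over all Gaussian variational distributions. -/
def IsSVGPOptimal (μ : 𝒳 → ℝ) (k : 𝒳 → 𝒳 → ℝ) (Z : Fin m → 𝒳) (σ : ℝ)
    (X : Fin n → 𝒳) (y : Fin n → ℝ)
    (a : EuclideanSpace ℝ (Fin m)) (S : Matrix (Fin m) (Fin m) ℝ) : Prop :=
  S.PosSemidef ∧ ∀ (a' : EuclideanSpace ℝ (Fin m)) (S' : Matrix (Fin m) (Fin m) ℝ),
    S'.PosSemidef → elbo μ k Z σ X y a' S' ≤ elbo μ k Z σ X y a S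

/-- `ν` is a probability law with finite first moment and mean vector `b`. -/
def HasMean (ν : Measure (EuclideanSpace ℝ (Fin t))) (b : Fin t → ℝ) : Prop :=
  IsProbabilityMeasure ν ∧ Integrable (fun f => f) ν ∧ ∀ i, (∫ f, f ∂ν) i = b i

/-- `μ(x) + k(x, Z) (K_ZX K_XZ + σ² K_ZZ)⁻¹ K_ZX (y - μ_X)`. -/
def inducingMean (μ : 𝒳 → ℝ) (k : 𝒳 → 𝒳 → ℝ) (Z : Fin m → 𝒳) (σ : ℝ)
    (X : Fin n → 𝒳) (y : Fin n → ℝ) (x : 𝒳) : ℝ :=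
  μ x + kvec k x Z ⬝ᵥ
    ((gram k Z X * gram k X Z + σ ^ 2 • gram k Z Z)⁻¹ *ᵥ
      (gram k Z X *ᵥ fun i => y i - μ (X i)))

end SparseGP

end

/-! All three approximations rest on one Gaussian law `𝒩(m*, S*)` of the inducing values `u`. In SoR
and DTC the training values are a function of `u`, so Bayes' rule tilts the prior of `u` by the
log-likelihood at the conditional mean (`posterior_jointPrior_detCond`), and completing the square
identifies the tilted prior as `𝒩(m*, S*)` (`inducingPrior_tilted`).

In SVGP the training values carry extra noise, but it is centred and its law does not depend on `u`.
As the log-likelihood is quadratic, the noise only adds a constant to its expectation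
(`integral_log_likelihood_svgpPosterior`). The Gibbs variational identity then turns the bound into
a constant minus `KL(q ‖ 𝒩(m*, S*))`, so `q` is optimal exactly when it is that law
(`isSVGPOptimal_iff`). The DTC posterior and the optimal SVGP posterior therefore coincide.

The test values are an affine function of `u` plus centred noise (zero for SoR), so each posterior
mean is that affine function at `m*` (`hasMean_bind`). The rest is matrix algebra: `K_ZZ⁻¹` cancels
the factor `K_ZZ` in `m* - μ_Z`, and a factorisation gives the second formula
(`gram_mul_lowRank_mul_gram`). -/

noncomputable section

/-! ### Exponential tilting and the Gibbs variational identity. -/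

namespace MeasureTheory

variable {α β : Type*} [MeasurableSpace α] [MeasurableSpace β]

/-- Tilting normalises, so the constant cancels. With `smul_tilted`, this lets Gaussian computations
ignore normalising constants and determinants. -/
lemma tilted_add_const (ν : Measure α) (f : α → ℝ) (c : ℝ) :
    ν.tilted (fun x => f x + c) = ν.tilted f := by
  have h : ∀ x, Real.exp (f x + c) / ∫ x, Real.exp (f x + c) ∂ν
      = Real.exp (f x) / ∫ x, Real.exp (f x) ∂ν := fun x => by
    simp_rw [Real.exp_add]
    rw [integral_mul_const, mul_div_mul_right _ _ (Real.exp_pos c).ne']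
  simp_rw [Measure.tilted, h]

lemma map_tilted_measurableEquiv (ν : Measure α) (e : α ≃ᵐ β) (f : α → ℝ) :
    (ν.tilted f).map e = (ν.map e).tilted (f ∘ e.symm) := by
  ext s hs
  rw [Measure.map_apply e.measurable hs, tilted_apply' _ _ (e.measurable hs), tilted_apply' _ _ hs,
    e.restrict_map, lintegral_map_equiv, integral_map_equiv]
  simp

lemma smul_tilted (ν : Measure α) {c : ℝ≥0∞} (hc : c ≠ 0) (hc' : c ≠ ∞) (f : α → ℝ) :
    (c • ν).tilted f = ν.tilted f := by
  have hpos : 0 < c.toReal := ENNReal.toReal_pos hc hc'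
  ext s hs
  rw [tilted_apply' _ _ hs, tilted_apply' _ _ hs, Measure.restrict_smul, lintegral_smul_measure,
    integral_smul_measure, smul_eq_mul, smul_eq_mul, ← lintegral_const_mul' _ _ hc']
  congr with x
  nth_rw 1 [← ENNReal.ofReal_toReal hc']
  rw [← ENNReal.ofReal_mul hpos.le]
  congr 1
  rw [mul_div_assoc', mul_div_mul_left _ _ hpos.ne']

/-- Without integrability the tilted measure is zero by convention, hence not a probability measure.
-/
lemma integrable_exp_of_isProbabilityMeasure_tilted {ν : Measure α} {f : α → ℝ}
    [h : IsProbabilityMeasure (ν.tilted f)] : Integrable (fun x => Real.exp (f x)) ν := by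
  by_contra hf
  rw [tilted_of_not_integrable hf] at h
  exact h.ne_zero _ rfl

/-- The Gibbs variational identity. -/
lemma coe_integral_sub_klDiv_eq (q p : Measure α) [IsProbabilityMeasure q]
    [IsProbabilityMeasure p] {f : α → ℝ} (hfq : Integrable f q)
    (hfp : Integrable (fun x => Real.exp (f x)) p) (c : ℝ) :
    ((∫ x, f x ∂q + c : ℝ) : EReal) - ((InformationTheory.klDiv q p : ℝ≥0∞) : EReal) =
      ((Real.log (∫ x, Real.exp (f x) ∂p) + c : ℝ) : EReal) -
        ((InformationTheory.klDiv q (p.tilted f) : ℝ≥0∞) : EReal) := by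
  have := isProbabilityMeasure_tilted hfp
  have hpt : p ≪ p.tilted f := absolutelyContinuous_tilted hfp
  have htp : p.tilted f ≪ p := tilted_absolutelyContinuous p f
  -- `p` and its tilt are mutually absolutely continuous, and the two log-likelihood ratios differ
  -- by `f` and a constant, which are `q`-integrable. So both divergences take the formula or both
  -- are `∞`; in the latter case both sides are `⊥`.
  by_cases hac : q ≪ p
  · by_cases hint : Integrable (llr q p) q
    · have hint' := integrable_llr_tilted_right hac hfq hint hfp
      have hac' := hac.trans hpt
      have h1 := InformationTheory.klDiv_ne_top hac hint
      have h2 := InformationTheory.klDiv_ne_top hac' hint'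
      rw [← EReal.coe_ennreal_toReal h1, ← EReal.coe_ennreal_toReal h2,
        InformationTheory.toReal_klDiv_of_measure_eq hac (by simp),
        InformationTheory.toReal_klDiv_of_measure_eq hac' (by simp),
        integral_llr_tilted_right hac hfq hfp hint, ← EReal.coe_sub, ← EReal.coe_sub]
      congr 1
      ring
    · have hint' : ¬ Integrable (llr q (p.tilted f)) q := fun h => hint <| by
        have h3 := (h.add hfq).add (integrable_const (-Real.log (∫ x, Real.exp (f x) ∂p)))
        refine h3.congr ?_
        filter_upwards [llr_tilted_right hac hfp] with x hx
        simp only [Pi.add_apply, hx]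
        ring
      rw [InformationTheory.klDiv_of_not_integrable hint,
        InformationTheory.klDiv_of_not_integrable hint']
      simp
  · have hac' : ¬ q ≪ p.tilted f := fun h => hac (h.trans htp)
    rw [InformationTheory.klDiv_of_not_ac hac, InformationTheory.klDiv_of_not_ac hac']
    simp

end MeasureTheory

/-! ### Gaussian laws as tilts of Lebesgue measure. -/

namespace ProbabilityTheory

/-- The characteristic functions agree: the Gaussian Fourier integral carries the same power of `π`
as the normalising integral, and the two cancel. -/
lemma stdGaussian_eq_tilted (E : Type*) [NormedAddCommGroup E] [InnerProductSpace ℝ E]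
    [FiniteDimensional ℝ E] [MeasurableSpace E] [BorelSpace E] :
    stdGaussian E = (volume : Measure E).tilted fun x => -(1 / 2) * ‖x‖ ^ 2 := by
  have hb : 0 < ((1 / 2 : ℝ) : ℂ).re := by norm_num
  have hZ := GaussianFourier.integral_rexp_neg_mul_sq_norm (V := E) (b := 1 / 2) (by norm_num)
  have hZpos : 0 < ∫ x : E, Real.exp (-(1 / 2) * ‖x‖ ^ 2) := by rw [hZ]; positivity
  have hint : Integrable fun x : E => Real.exp (-(1 / 2) * ‖x‖ ^ 2) := by
    by_contra h
    exact hZpos.ne' (integral_undef h)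
  have := isProbabilityMeasure_tilted hint
  refine Measure.ext_of_charFun ?_
  ext t
  have h1 := GaussianFourier.integral_cexp_neg_mul_sq_norm_add (V := E) hb Complex.I t
  have h2 := GaussianFourier.integral_cexp_neg_mul_sq_norm (V := E) hb
  have hZ' : ((∫ x : E, Real.exp (-(1 / 2) * ‖x‖ ^ 2) : ℝ) : ℂ) =
      (Real.pi / (1 / 2 : ℝ)) ^ (Module.finrank ℝ E / 2 : ℂ) := by
    rw [← h2, ← integral_complex_ofReal]
    congr 1 with x
    push_cast
    rfl
  have hZne : ((∫ x : E, Real.exp (-(1 / 2) * ‖x‖ ^ 2) : ℝ) : ℂ) ≠ 0 := by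
    exact_mod_cast hZpos.ne'
  rw [charFun_stdGaussian, charFun_apply, integral_tilted]
  have h3 : ∀ x : E, (Real.exp (-(1 / 2) * ‖x‖ ^ 2) / ∫ x : E, Real.exp (-(1 / 2) * ‖x‖ ^ 2)) •
      Complex.exp (inner ℝ x t * Complex.I) =
      (((∫ x : E, Real.exp (-(1 / 2) * ‖x‖ ^ 2) : ℝ) : ℂ))⁻¹ *
        Complex.exp (-(1 / 2 : ℝ) * ‖x‖ ^ 2 + Complex.I * inner ℝ t x) := fun x => by
    rw [Complex.exp_add, real_inner_comm, Complex.real_smul, mul_comm Complex.I]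
    push_cast
    ring
  simp_rw [h3]
  rw [integral_const_mul, h1, ← hZ', ← mul_assoc, inv_mul_cancel₀ hZne, one_mul]
  congr 1
  rw [Complex.I_sq]
  push_cast
  ring

open scoped MatrixOrder in
/-- A nondegenerate Gaussian has density proportional to
`exp (-(x - a)ᵀ S⁻¹ (x - a) / 2)`. -/
lemma multivariateGaussian_eq_tilted {ι : Type*} [Fintype ι] [DecidableEq ι]
    (a : EuclideanSpace ℝ ι) {S : Matrix ι ι ℝ} (hS : S.PosDef) :
    multivariateGaussian a S = (volume : Measure (EuclideanSpace ℝ ι)).tilted fun x =>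
      -(1 / 2) * ((x - a).ofLp ⬝ᵥ S⁻¹ *ᵥ (x - a).ofLp) := by
  set R := CFC.sqrt S with hR
  have hRR : R * R = S := CFC.sqrt_mul_sqrt_self _ hS.posSemidef.nonneg
  have hRT : Rᵀ = R := by
    have := (CFC.sqrt_nonneg S).posSemidef.1
    rwa [IsHermitian, conjTranspose_eq_transpose_of_trivial] at this
  have hdet : IsUnit R.det := by
    have := (isUnit_iff_isUnit_det _).1 hS.isUnit
    rw [← hRR, det_mul] at this
    exact isUnit_of_mul_isUnit_left this
  let L : EuclideanSpace ℝ ι ≃L[ℝ] EuclideanSpace ℝ ι :=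
    ContinuousLinearEquiv.equivOfInverse (toEuclideanCLM (𝕜 := ℝ) R) (toEuclideanCLM (𝕜 := ℝ) R⁻¹)
      (fun x => by
        rw [← mul_apply_eq_comp, ← map_mul, nonsing_inv_mul _ hdet, map_one]; rfl)
      (fun x => by
        rw [← mul_apply_eq_comp, ← map_mul, mul_nonsing_inv _ hdet, map_one]; rfl)
  let e₁ : EuclideanSpace ℝ ι ≃ᵐ EuclideanSpace ℝ ι := L.toHomeomorph.toMeasurableEquiv
  let e : EuclideanSpace ℝ ι ≃ᵐ EuclideanSpace ℝ ι := e₁.trans (MeasurableEquiv.addLeft a)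
  have he : multivariateGaussian a S = (stdGaussian (EuclideanSpace ℝ ι)).map e := rfl
  have hL : LinearMap.det (L.toLinearEquiv : EuclideanSpace ℝ ι →ₗ[ℝ] EuclideanSpace ℝ ι) ≠ 0 :=
    (LinearEquiv.isUnit_det' L.toLinearEquiv).ne_zero
  -- The affine map `x ↦ a + S^{1/2} x` only rescales Lebesgue measure, and tilting forgets the
  -- factor, so the determinant is never evaluated.
  obtain ⟨c, hc, hc', hvol⟩ : ∃ c : ℝ≥0∞, c ≠ 0 ∧ c ≠ ∞ ∧
      (volume : Measure (EuclideanSpace ℝ ι)).map e = c • volume := by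
    refine ⟨ENNReal.ofReal |(LinearMap.det (L.toLinearEquiv :
      EuclideanSpace ℝ ι →ₗ[ℝ] EuclideanSpace ℝ ι))⁻¹|, ?_, ENNReal.ofReal_ne_top, ?_⟩
    · simpa using hL
    · have h1 := Measure.map_linearMap_addHaar_eq_smul_addHaar
        (volume : Measure (EuclideanSpace ℝ ι)) hL
      have h2 : (e : EuclideanSpace ℝ ι → EuclideanSpace ℝ ι) =
        (fun x => a + x) ∘ (L.toLinearEquiv : EuclideanSpace ℝ ι →ₗ[ℝ] EuclideanSpace ℝ ι) := rfl
      rw [h2, ← Measure.map_map (by fun_prop) (by exact L.continuous.measurable), h1,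
        Measure.map_smul, map_add_left_eq_self]
  rw [he, stdGaussian_eq_tilted, map_tilted_measurableEquiv, hvol, smul_tilted _ hc hc']
  congr 1 with x
  have hx : e.symm x = toEuclideanCLM (𝕜 := ℝ) R⁻¹ (x - a) := by
    rw [sub_eq_neg_add]; rfl
  rw [Function.comp_apply, hx, EuclideanSpace.real_norm_sq_eq]
  congr 1
  have hS' : S⁻¹ = (R⁻¹)ᵀ * R⁻¹ := by
    rw [transpose_nonsing_inv, hRT, ← Matrix.mul_inv_rev, hRR]
  rw [hS', ← mulVec_mulVec, dotProduct_mulVec, vecMul_transpose]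
  simp [dotProduct, sq, mulVec_sub]

end ProbabilityTheory

/-! ### Means of mixtures of the conditionals. -/

namespace SparseGP

variable {𝒳 : Type*} {m n t : ℕ}

lemma condMean_eq (μ : 𝒳 → ℝ) (k : 𝒳 → 𝒳 → ℝ) (Z : Fin m → 𝒳) (A : Fin t → 𝒳)
    (u : EuclideanSpace ℝ (Fin m)) :
    condMean μ k Z A u = condMean μ k Z A 0 +
      LinearMap.toContinuousLinearMap (toEuclideanLin (gram k A Z * (gram k Z Z)⁻¹)) u := by
  have h : (fun j => u j - μ (Z j)) = (fun j => (0 : EuclideanSpace ℝ (Fin m)) j - μ (Z j)) +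
      u.ofLp := by
    ext j; simp; ring
  ext i
  simp only [condMean, h, mulVec_add, dotProduct_add, PiLp.add_apply,
    LinearMap.coe_toContinuousLinearMap', toLpLin_apply, ← mulVec_mulVec]
  rw [add_assoc]
  rfl

lemma integral_condMean (μ : 𝒳 → ℝ) (k : 𝒳 → 𝒳 → ℝ) (Z : Fin m → 𝒳) (A : Fin t → 𝒳)
    {q : Measure (EuclideanSpace ℝ (Fin m))} [IsProbabilityMeasure q]
    (hq : Integrable (fun u => u) q) :
    Integrable (condMean μ k Z A) q ∧
      ∫ u, condMean μ k Z A u ∂q = condMean μ k Z A (∫ u, u ∂q) := by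
  have h := ContinuousLinearMap.integrable_comp
    (LinearMap.toContinuousLinearMap (toEuclideanLin (gram k A Z * (gram k Z Z)⁻¹))) hq
  constructor
  · refine ((integrable_const (condMean μ k Z A 0)).add h).congr (ae_of_all _ fun u => ?_)
    exact (condMean_eq μ k Z A u).symm
  · rw [condMean_eq μ k Z A (∫ u, u ∂q), ← ContinuousLinearMap.integral_comp_comm _ hq]
    rw [integral_congr_ae (ae_of_all _ (condMean_eq μ k Z A)), integral_add (integrable_const _) h]
    simp

/-- The noise law `ν` does not depend on `u`, so the mixture is the law of a sum with `u` and the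
noise independent. -/
lemma bind_eq_map_prod (μ : 𝒳 → ℝ) (k : 𝒳 → 𝒳 → ℝ) (Z : Fin m → 𝒳) (A : Fin t → 𝒳)
    (q : Measure (EuclideanSpace ℝ (Fin m))) {ν : Measure (EuclideanSpace ℝ (Fin t))}
    [SFinite ν] {κ : Kernel (EuclideanSpace ℝ (Fin m)) (EuclideanSpace ℝ (Fin t))}
    (hκ : ∀ u, κ u = ν.map (condMean μ k Z A u + ·)) :
    q.bind κ = (q.prod ν).map fun p => condMean μ k Z A p.1 + p.2 := by
  have hm := measurable_condMean μ k Z A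
  have hm' : Measurable fun p : EuclideanSpace ℝ (Fin m) × EuclideanSpace ℝ (Fin t) =>
      condMean μ k Z A p.1 + p.2 := by fun_prop
  ext s hs
  rw [Measure.bind_apply hs κ.aemeasurable, Measure.map_apply hm' hs,
    Measure.prod_apply (hm' hs)]
  refine lintegral_congr fun u => ?_
  rw [hκ, Measure.map_apply (by fun_prop) hs]
  rfl

/-- Centred noise does not move the mean, and an affine map commutes with expectation. This is why
deterministic and exact test conditionals give the same mean. -/
lemma hasMean_bind (μ : 𝒳 → ℝ) (k : 𝒳 → 𝒳 → ℝ) (Z : Fin m → 𝒳) (A : Fin t → 𝒳)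
    {q : Measure (EuclideanSpace ℝ (Fin m))} [IsProbabilityMeasure q]
    (hq : Integrable (fun u => u) q)
    {ν : Measure (EuclideanSpace ℝ (Fin t))} [IsProbabilityMeasure ν]
    (hν : Integrable (fun w => w) ν) (hν0 : ∫ w, w ∂ν = 0)
    {κ : Kernel (EuclideanSpace ℝ (Fin m)) (EuclideanSpace ℝ (Fin t))}
    (hκ : ∀ u, κ u = ν.map (condMean μ k Z A u + ·)) :
    HasMean (q.bind κ) (condMean μ k Z A (∫ u, u ∂q)) := by
  have hm := measurable_condMean μ k Z A
  have hm' : Measurable fun p : EuclideanSpace ℝ (Fin m) × EuclideanSpace ℝ (Fin t) =>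
      condMean μ k Z A p.1 + p.2 := by fun_prop
  obtain ⟨h1, h2⟩ := integral_condMean μ k Z A hq
  rw [bind_eq_map_prod μ k Z A q hκ]
  refine ⟨Measure.isProbabilityMeasure_map hm'.aemeasurable, ?_, fun i => ?_⟩
  · exact (integrable_map_measure (by fun_prop) hm'.aemeasurable).2
      ((h1.comp_fst ν).add (hν.comp_snd q))
  · rw [integral_map hm'.aemeasurable (by fun_prop),
      integral_add (h1.comp_fst ν) (hν.comp_snd q), integral_fun_fst,
      integral_fun_snd (fun w => w), hν0, h2]
    simp

lemma detCond_apply_eq_map (μ : 𝒳 → ℝ) (k : 𝒳 → 𝒳 → ℝ) (Z : Fin m → 𝒳) (A : Fin t → 𝒳)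
    (u : EuclideanSpace ℝ (Fin m)) :
    detCond μ k Z A u = (Measure.dirac 0).map (condMean μ k Z A u + ·) := by
  rw [detCond, Kernel.deterministic_apply, Measure.map_dirac' (by fun_prop), add_zero]

/-- `multivariateGaussian` is an affine image of the standard Gaussian for any matrix, so the
conditional covariance need not be shown positive semidefinite. -/
lemma exactCond_apply_eq_map (μ : 𝒳 → ℝ) (k : 𝒳 → 𝒳 → ℝ) (Z : Fin m → 𝒳) (A : Fin t → 𝒳)
    (u : EuclideanSpace ℝ (Fin m)) :
    exactCond μ k Z A u = (multivariateGaussian 0 (gram k A A - gram (lowRank k Z) A A)).map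
      (condMean μ k Z A u + ·) := by
  change multivariateGaussian _ _ = _
  rw [multivariateGaussian, multivariateGaussian, Measure.map_map (by fun_prop) (by fun_prop)]
  simp [Function.comp_def]

lemma hasMean_bind_detCond (μ : 𝒳 → ℝ) (k : 𝒳 → 𝒳 → ℝ) (Z : Fin m → 𝒳) (A : Fin t → 𝒳)
    (a : EuclideanSpace ℝ (Fin m)) (S : Matrix (Fin m) (Fin m) ℝ) :
    HasMean ((multivariateGaussian a S).bind (detCond μ k Z A)) (condMean μ k Z A a) := by
  have h := hasMean_bind μ k Z A (q := multivariateGaussian a S) IsGaussian.integrable_fun_id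
    (integrable_dirac (by simp)) (by simp) (detCond_apply_eq_map μ k Z A)
  rwa [integral_id_multivariateGaussian] at h

lemma hasMean_svgpPosterior (μ : 𝒳 → ℝ) (k : 𝒳 → 𝒳 → ℝ) (Z : Fin m → 𝒳) (A : Fin t → 𝒳)
    (a : EuclideanSpace ℝ (Fin m)) (S : Matrix (Fin m) (Fin m) ℝ) :
    HasMean (svgpPosterior μ k Z a S A) (condMean μ k Z A a) := by
  have h := hasMean_bind μ k Z A (q := multivariateGaussian a S) IsGaussian.integrable_fun_id
    IsGaussian.integrable_fun_id (by simp) (exactCond_apply_eq_map μ k Z A)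
  rwa [integral_id_multivariateGaussian] at h

/-! ### The likelihood and Bayes' rule. -/

lemma measurable_likelihood (σ : ℝ) (y : Fin n → ℝ) : Measurable (likelihood σ y) := by
  have h : ∀ i, Measurable fun f : EuclideanSpace ℝ (Fin n) =>
      gaussianPDFReal (f i) ⟨σ ^ 2, sq_nonneg σ⟩ (y i) := fun i => by
    unfold gaussianPDFReal
    fun_prop
  exact Finset.measurable_prod _ fun i _ => h i

lemma likelihood_pos {σ : ℝ} (hσ : 0 < σ) (y : Fin n → ℝ) (f : EuclideanSpace ℝ (Fin n)) :
    0 < likelihood σ y f := by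
  refine Finset.prod_pos fun i _ => gaussianPDFReal_pos _ _ _ fun h => ?_
  exact (pow_pos hσ 2).ne' (congrArg NNReal.toReal h)

/-- Comparison with the value at `f = y`, where the exponentials equal 1, keeps the normalising
factor opaque and also shows that the likelihood is bounded. -/
lemma log_likelihood {σ : ℝ} (hσ : 0 < σ) (y : Fin n → ℝ) (f : EuclideanSpace ℝ (Fin n)) :
    Real.log (likelihood σ y f) =
      Real.log (likelihood σ y (WithLp.toLp 2 y)) - (∑ i, (y i - f i) ^ 2) / (2 * σ ^ 2) := by
  have h : likelihood σ y f = likelihood σ y (WithLp.toLp 2 y) *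
      Real.exp (-((∑ i, (y i - f i) ^ 2) / (2 * σ ^ 2))) := by
    rw [Finset.sum_div, ← Finset.sum_neg_distrib, Real.exp_sum, likelihood, likelihood,
      ← Finset.prod_mul_distrib]
    refine Finset.prod_congr rfl fun i _ => ?_
    simp only [gaussianPDFReal, neg_div, sub_self, ne_eq, OfNat.ofNat_ne_zero, not_false_eq_true,
      zero_pow, zero_div, neg_zero, Real.exp_zero, mul_one]
    rfl
  rw [h, Real.log_mul (likelihood_pos hσ y _).ne' (Real.exp_pos _).ne', Real.log_exp]
  ring

/-- With a deterministic training conditional, conditioning on the observations amounts to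
tilting the inducing prior by the log-likelihood. -/
lemma posterior_jointPrior_detCond (μ : 𝒳 → ℝ) (k : 𝒳 → 𝒳 → ℝ) (Z : Fin m → 𝒳) {σ : ℝ}
    (hσ : 0 < σ) (X : Fin n → 𝒳) (y : Fin n → ℝ) (p : Measure (EuclideanSpace ℝ (Fin m)))
    (hint : Integrable (fun u => likelihood σ y (condMean μ k Z X u)) p)
    (κ : Kernel (EuclideanSpace ℝ (Fin m)) (EuclideanSpace ℝ (Fin t))) [IsMarkovKernel κ] :
    posterior σ y (jointPrior p (detCond μ k Z X) κ) =
      (p.tilted fun u => Real.log (likelihood σ y (condMean μ k Z X u))).bind κ := by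
  have hm := measurable_condMean μ k Z X
  have hl := measurable_likelihood σ y
  have hmeas : Measurable fun z : EuclideanSpace ℝ (Fin n) × EuclideanSpace ℝ (Fin t) =>
      ENNReal.ofReal (likelihood σ y z.1) := by fun_prop
  -- The training coordinate is a point mass given `u`, so its integral collapses to evaluation.
  have key : ∀ F : EuclideanSpace ℝ (Fin n) × EuclideanSpace ℝ (Fin t) → ℝ≥0∞, Measurable F →
      ∫⁻ z, F z ∂(jointPrior p (detCond μ k Z X) κ) =
        ∫⁻ u, ∫⁻ w, F (condMean μ k Z X u, w) ∂(κ u) ∂p := fun F hF => by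
    rw [jointPrior, Measure.lintegral_bind (Kernel.aemeasurable _) hF.aemeasurable]
    refine lintegral_congr fun u => ?_
    rw [Kernel.prod_apply, detCond, Kernel.deterministic_apply, lintegral_prod _ hF.aemeasurable,
      lintegral_dirac' _ (Measurable.lintegral_prod_right' hF)]
  have hexp : ∀ u, Real.exp (Real.log (likelihood σ y (condMean μ k Z X u))) =
      likelihood σ y (condMean μ k Z X u) := fun u => Real.exp_log (likelihood_pos hσ y _)
  have hZ : ∫⁻ z, ENNReal.ofReal (likelihood σ y z.1) ∂(jointPrior p (detCond μ k Z X) κ) =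
      ENNReal.ofReal (∫ u, likelihood σ y (condMean μ k Z X u) ∂p) := by
    rw [key _ hmeas, ofReal_integral_eq_lintegral_ofReal hint
      (ae_of_all _ fun u => (likelihood_pos hσ y _).le)]
    simp
  rcases eq_zero_or_neZero p with rfl | hp
  · simp [posterior, jointPrior]
  have hpos : 0 < ∫ u, likelihood σ y (condMean μ k Z X u) ∂p := by
    have h := integral_exp_pos (hint.congr (ae_of_all _ fun u => (hexp u).symm))
    rwa [integral_congr_ae (ae_of_all _ hexp)] at h
  ext s hs
  rw [posterior, Measure.map_apply measurable_snd hs, Measure.smul_apply, smul_eq_mul, hZ,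
    withDensity_apply _ (measurable_snd hs), Measure.bind_apply hs κ.aemeasurable,
    lintegral_tilted, ← lintegral_indicator (measurable_snd hs),
    key _ (hmeas.indicator (measurable_snd hs)), ← lintegral_const_mul' _ _ (by simpa using hpos)]
  refine lintegral_congr fun u => ?_
  have h1 : ∀ w, (Prod.snd ⁻¹' s).indicator (fun z : EuclideanSpace ℝ (Fin n) ×
      EuclideanSpace ℝ (Fin t) => ENNReal.ofReal (likelihood σ y z.1)) (condMean μ k Z X u, w) =
      s.indicator (fun _ => ENNReal.ofReal (likelihood σ y (condMean μ k Z X u))) w := fun w => by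
    by_cases hw : w ∈ s <;> simp [hw]
  simp_rw [h1, hexp]
  rw [lintegral_indicator_const hs, ENNReal.ofReal_div_of_pos hpos, ← mul_assoc,
    ENNReal.div_eq_inv_mul]

end SparseGP

/-! ### Kernel matrix algebra and Gaussian conjugacy. -/

namespace SparseGP

variable {𝒳 : Type*} {m n t : ℕ}

lemma transpose_gram {k : 𝒳 → 𝒳 → ℝ} (hk : (Matrix.of k).PosSemidef) (A : Fin n → 𝒳)
    (B : Fin m → 𝒳) : (gram k A B)ᵀ = gram k B A := by
  ext i j
  exact (hk.1.apply (B i) (A j)).trans rfl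

lemma mulVec_gram_injective {k : 𝒳 → 𝒳 → ℝ} {X : Fin n → 𝒳} {Z : Fin m → 𝒳}
    (hrank : (gram k X Z).rank = m) : Function.Injective (gram k X Z).mulVec := by
  rw [mulVec_injective_iff, linearIndependent_iff_card_eq_finrank_span, Set.finrank,
    ← Matrix.rank_eq_finrank_span_cols, hrank, Fintype.card_fin]

/-- If `vᵀ K_ZZ v = 0`, then `(0, v)` has zero quadratic form, hence lies in the kernel, for the
semidefinite matrix over `X` and `Z` jointly. Its upper block gives `K_XZ v = 0`, and full column
rank forces `v = 0`. -/
lemma posDef_gram {k : 𝒳 → 𝒳 → ℝ} (hk : (Matrix.of k).PosSemidef) {X : Fin n → 𝒳}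
    {Z : Fin m → 𝒳} (hrank : (gram k X Z).rank = m) : (gram k Z Z).PosDef := by
  have hZ : (gram k Z Z).PosSemidef := hk.submatrix Z
  refine PosDef.of_dotProduct_mulVec_pos hZ.1 fun v hv => ?_
  refine lt_of_le_of_ne (hZ.dotProduct_mulVec_nonneg v) fun h => hv ?_
  have hW : ((Matrix.of k).submatrix (Sum.elim X Z) (Sum.elim X Z)).PosSemidef := hk.submatrix _
  have hB : (Matrix.of k).submatrix (Sum.elim X Z) (Sum.elim X Z) =
      fromBlocks (gram k X X) (gram k X Z) (gram k Z X) (gram k Z Z) := by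
    ext (i | i) (j | j) <;> rfl
  rw [hB] at hW
  have hmul : fromBlocks (gram k X X) (gram k X Z) (gram k Z X) (gram k Z Z) *ᵥ Sum.elim 0 v =
      Sum.elim (gram k X Z *ᵥ v) (gram k Z Z *ᵥ v) := by
    simp only [fromBlocks_mulVec, Sum.elim_comp_inl, Sum.elim_comp_inr, mulVec_zero, zero_add]
  have h0 := (hW.dotProduct_mulVec_zero_iff (Sum.elim 0 v)).1 (by
    rw [hmul, star_trivial, sumElim_dotProduct_sumElim, zero_dotProduct, zero_add]
    exact h.symm)
  rw [hmul] at h0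
  have h1 : gram k X Z *ᵥ v = 0 := funext fun i => congrFun h0 (Sum.inl i)
  exact mulVec_gram_injective hrank (h1.trans (mulVec_zero _).symm)

lemma posDef_gram_mul_gram {k : 𝒳 → 𝒳 → ℝ} (hk : (Matrix.of k).PosSemidef) {X : Fin n → 𝒳}
    {Z : Fin m → 𝒳} (hrank : (gram k X Z).rank = m) : (gram k Z X * gram k X Z).PosDef := by
  have := PosDef.conjTranspose_mul_self _ (mulVec_gram_injective hrank)
  rwa [conjTranspose_eq_transpose_of_trivial, transpose_gram hk] at this

lemma posDef_precision {k : 𝒳 → 𝒳 → ℝ} (hk : (Matrix.of k).PosSemidef) {X : Fin n → 𝒳}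
    {Z : Fin m → 𝒳} (hrank : (gram k X Z).rank = m) {σ : ℝ} (hσ : 0 < σ) :
    (gram k Z X * gram k X Z + σ ^ 2 • gram k Z Z).PosDef :=
  (posDef_gram_mul_gram hk hrank).add ((posDef_gram hk hrank).smul (pow_pos hσ 2))

lemma gram_lowRank (k : 𝒳 → 𝒳 → ℝ) (Z : Fin m → 𝒳) (A : Fin n → 𝒳) (B : Fin t → 𝒳) :
    gram (lowRank k Z) A B = gram k A Z * (gram k Z Z)⁻¹ * gram k Z B := by
  rw [Matrix.mul_assoc]
  ext i j
  rw [mul_apply]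
  simp only [gram, lowRank, of_apply, kvec, dotProduct, mulVec, mul_apply]

lemma kvec_lowRank (k : 𝒳 → 𝒳 → ℝ) (Z : Fin m → 𝒳) (x : 𝒳) (X : Fin n → 𝒳) :
    kvec (lowRank k Z) x X = kvec k x Z ᵥ* ((gram k Z Z)⁻¹ * gram k Z X) := by
  ext j
  simp only [kvec, lowRank, vecMul, dotProduct, mulVec, mul_apply, gram, of_apply]

/-- Insert `K_ZZ K_ZZ⁻¹` into the `σ²` term and factor. This yields both the invertibility of the
left side and the second formula for the mean. -/
lemma gram_mul_lowRank_mul_gram {k : 𝒳 → 𝒳 → ℝ} (hk : (Matrix.of k).PosSemidef) {X : Fin n → 𝒳}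
    {Z : Fin m → 𝒳} (hrank : (gram k X Z).rank = m) (σ : ℝ) :
    gram k Z X * (gram (lowRank k Z) X X + σ ^ 2 • (1 : Matrix (Fin n) (Fin n) ℝ)) * gram k X Z =
      (gram k Z X * gram k X Z + σ ^ 2 • gram k Z Z) * (gram k Z Z)⁻¹ *
        (gram k Z X * gram k X Z) := by
  have hK := (isUnit_iff_isUnit_det _).1 (posDef_gram hk hrank).isUnit
  rw [gram_lowRank, Matrix.add_mul _ _ (gram k Z Z)⁻¹, Matrix.smul_mul, mul_nonsing_inv _ hK]
  simp only [Matrix.mul_add, Matrix.add_mul, Matrix.mul_assoc, Matrix.smul_mul, Matrix.mul_smul,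
    Matrix.one_mul]

/-- With `T = K_ZX K_XZ` and `M = T + σ² K_ZZ`, the factorisation gives `K_ZZ⁻¹ T (M K_ZZ⁻¹ T)⁻¹ =
M⁻¹`. -/
lemma inducingMean_eq_lowRank {k : 𝒳 → 𝒳 → ℝ} (hk : (Matrix.of k).PosSemidef) {X : Fin n → 𝒳}
    {Z : Fin m → 𝒳} (hrank : (gram k X Z).rank = m) {σ : ℝ} (μ : 𝒳 → ℝ)
    (y : Fin n → ℝ) (x : 𝒳) :
    inducingMean μ k Z σ X y x = μ x + kvec (lowRank k Z) x X ⬝ᵥ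
      (gram k X Z *ᵥ ((gram k Z X *
        (gram (lowRank k Z) X X + σ ^ 2 • (1 : Matrix (Fin n) (Fin n) ℝ)) * gram k X Z)⁻¹ *ᵥ
          (gram k Z X *ᵥ fun i => y i - μ (X i)))) := by
  have hK := (isUnit_iff_isUnit_det _).1 (posDef_gram hk hrank).isUnit
  have hT := (isUnit_iff_isUnit_det _).1 (posDef_gram_mul_gram hk hrank).isUnit
  have hinv : (gram k Z Z)⁻¹ * gram k Z X * gram k X Z * (gram k Z X *
      (gram (lowRank k Z) X X + σ ^ 2 • (1 : Matrix (Fin n) (Fin n) ℝ)) * gram k X Z)⁻¹ =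
      (gram k Z X * gram k X Z + σ ^ 2 • gram k Z Z)⁻¹ := by
    rw [gram_mul_lowRank_mul_gram hk hrank, Matrix.mul_inv_rev, Matrix.mul_inv_rev,
      nonsing_inv_nonsing_inv _ hK, Matrix.mul_assoc (gram k Z Z)⁻¹, Matrix.mul_assoc (gram k Z Z)⁻¹,
      ← Matrix.mul_assoc (gram k Z X * gram k X Z), mul_nonsing_inv _ hT, Matrix.one_mul,
      ← Matrix.mul_assoc, nonsing_inv_mul _ hK, Matrix.one_mul]
  rw [kvec_lowRank, inducingMean, ← hinv]
  simp only [mulVec_mulVec, ← dotProduct_mulVec, Matrix.mul_assoc]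

/-- Mean of the conditional law of the inducing variables given the observations. -/
def inducingPosteriorMean (μ : 𝒳 → ℝ) (k : 𝒳 → 𝒳 → ℝ) (Z : Fin m → 𝒳) (σ : ℝ)
    (X : Fin n → 𝒳) (y : Fin n → ℝ) : EuclideanSpace ℝ (Fin m) :=
  WithLp.toLp 2 ((fun j => μ (Z j)) + gram k Z Z *ᵥ
    ((gram k Z X * gram k X Z + σ ^ 2 • gram k Z Z)⁻¹ *ᵥ
      (gram k Z X *ᵥ fun i => y i - μ (X i))))

/-- Covariance of the conditional law of the inducing variables given the observations. -/
def inducingPosteriorCov (k : 𝒳 → 𝒳 → ℝ) (Z : Fin m → 𝒳) (σ : ℝ) (X : Fin n → 𝒳) :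
    Matrix (Fin m) (Fin m) ℝ :=
  σ ^ 2 • (gram k Z Z * (gram k Z X * gram k X Z + σ ^ 2 • gram k Z Z)⁻¹ * gram k Z Z)

lemma posDef_inducingPosteriorCov {k : 𝒳 → 𝒳 → ℝ} (hk : (Matrix.of k).PosSemidef)
    {X : Fin n → 𝒳} {Z : Fin m → 𝒳} (hrank : (gram k X Z).rank = m) {σ : ℝ} (hσ : 0 < σ) :
    (inducingPosteriorCov k Z σ X).PosDef := by
  have hK := posDef_gram hk hrank
  have h := (posDef_precision hk hrank hσ).inv.conjTranspose_mul_mul_same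
    (mulVec_injective_iff_isUnit.2 hK.isUnit)
  rw [hK.1.eq] at h
  exact h.smul (pow_pos hσ 2)

lemma condMean_inducingPosteriorMean {k : 𝒳 → 𝒳 → ℝ} (hk : (Matrix.of k).PosSemidef)
    {X : Fin n → 𝒳} {Z : Fin m → 𝒳} (hrank : (gram k X Z).rank = m) (σ : ℝ) (μ : 𝒳 → ℝ)
    (y : Fin n → ℝ) (A : Fin t → 𝒳) (i : Fin t) :
    condMean μ k Z A (inducingPosteriorMean μ k Z σ X y) i =
      inducingMean μ k Z σ X y (A i) := by
  have hK := (isUnit_iff_isUnit_det _).1 (posDef_gram hk hrank).isUnit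
  simp only [condMean, inducingPosteriorMean, inducingMean, Pi.add_apply, add_sub_cancel_left]
  congr 2
  change (gram k Z Z)⁻¹ *ᵥ (gram k Z Z *ᵥ _) = _
  rw [mulVec_mulVec, nonsing_inv_mul _ hK, one_mulVec]

/-- Completing the square in the exponent of a Gaussian prior times a Gaussian likelihood. -/
lemma complete_square {K M : Matrix (Fin m) (Fin m) ℝ} {G : Matrix (Fin n) (Fin m) ℝ} {s : ℝ}
    (hs : s ≠ 0) (hM : M = Gᵀ * G + s • K) (hMT : Mᵀ = M) {r : Fin n → ℝ} {v d : Fin m → ℝ}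
    (hd : M *ᵥ d = Gᵀ *ᵥ r) :
    -(1 / 2) * (v ⬝ᵥ K *ᵥ v) - ((r - G *ᵥ v) ⬝ᵥ (r - G *ᵥ v)) / (2 * s) =
      -(1 / 2) * (s⁻¹ * ((v - d) ⬝ᵥ M *ᵥ (v - d))) + (d ⬝ᵥ Gᵀ *ᵥ r - r ⬝ᵥ r) / (2 * s) := by
  have h1 : v ⬝ᵥ M *ᵥ v = (G *ᵥ v) ⬝ᵥ (G *ᵥ v) + s * (v ⬝ᵥ K *ᵥ v) := by
    rw [hM, add_mulVec, dotProduct_add, ← mulVec_mulVec, dotProduct_mulVec, vecMul_transpose,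
      smul_mulVec, dotProduct_smul, smul_eq_mul]
  have h2 : v ⬝ᵥ Gᵀ *ᵥ r = (G *ᵥ v) ⬝ᵥ r := by rw [dotProduct_mulVec, vecMul_transpose]
  have h3 : d ⬝ᵥ M *ᵥ v = (G *ᵥ v) ⬝ᵥ r := by
    rw [dotProduct_mulVec, ← mulVec_transpose, hMT, hd, dotProduct_comm, h2]
  have h4 : (v - d) ⬝ᵥ M *ᵥ (v - d) = (G *ᵥ v) ⬝ᵥ (G *ᵥ v) + s * (v ⬝ᵥ K *ᵥ v) -
      2 * ((G *ᵥ v) ⬝ᵥ r) + d ⬝ᵥ Gᵀ *ᵥ r := by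
    rw [mulVec_sub, sub_dotProduct, dotProduct_sub, dotProduct_sub, h1, h3, hd, h2]
    ring
  have h5 : (r - G *ᵥ v) ⬝ᵥ (r - G *ᵥ v) =
      r ⬝ᵥ r - 2 * ((G *ᵥ v) ⬝ᵥ r) + (G *ᵥ v) ⬝ᵥ (G *ᵥ v) := by
    rw [sub_dotProduct, dotProduct_sub, dotProduct_sub, dotProduct_comm r (G *ᵥ v)]
    ring
  rw [h4, h5]
  field_simp
  ring

/-- Conjugacy: tilting the inducing prior by the log-likelihood gives a Gaussian. -/
lemma inducingPrior_tilted {k : 𝒳 → 𝒳 → ℝ} (hk : (Matrix.of k).PosSemidef)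
    {X : Fin n → 𝒳} {Z : Fin m → 𝒳} (hrank : (gram k X Z).rank = m) {σ : ℝ} (hσ : 0 < σ)
    (μ : 𝒳 → ℝ) (y : Fin n → ℝ) :
    (inducingPrior μ k Z).tilted (fun u => Real.log (likelihood σ y (condMean μ k Z X u))) =
      multivariateGaussian (inducingPosteriorMean μ k Z σ X y) (inducingPosteriorCov k Z σ X) := by
  have hKp := posDef_gram hk hrank
  have hK := (isUnit_iff_isUnit_det _).1 hKp.isUnit
  have hMp := posDef_precision hk hrank hσ
  have hM := (isUnit_iff_isUnit_det _).1 hMp.isUnit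
  have hσ2 : σ ^ 2 ≠ 0 := (pow_pos hσ 2).ne'
  have hprior := multivariateGaussian_eq_tilted (WithLp.toLp 2 fun j => μ (Z j)) hKp
  have hprob : IsProbabilityMeasure (multivariateGaussian
    (WithLp.toLp 2 fun j => μ (Z j)) (gram k Z Z)) := inferInstance
  -- Having total mass 1 supplies the integrability needed to compose the two tilts.
  rw [hprior] at hprob
  rw [inducingPrior, hprior, tilted_tilted integrable_exp_of_isProbabilityMeasure_tilted,
    multivariateGaussian_eq_tilted _ (posDef_inducingPosteriorCov hk hrank hσ)]
  set r : Fin n → ℝ := fun i => y i - μ (X i) with hr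
  set M := gram k Z X * gram k X Z + σ ^ 2 • gram k Z Z with hMdef
  set d := M⁻¹ *ᵥ (gram k Z X *ᵥ r) with hd
  have hMd : M *ᵥ d = (gram k X Z)ᵀ *ᵥ r := by
    rw [hd, mulVec_mulVec, mul_nonsing_inv _ hM, one_mulVec, transpose_gram hk]
  have hMT : Mᵀ = M := by
    have := hMp.1
    rwa [IsHermitian, conjTranspose_eq_transpose_of_trivial] at this
  have hMG : M = (gram k X Z)ᵀ * gram k X Z + σ ^ 2 • gram k Z Z := by rw [transpose_gram hk]
  -- The added constant is the maximal log-likelihood plus the remainder of the completed square.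
  refine Eq.trans ?_ (tilted_add_const _ _ (Real.log (likelihood σ y (WithLp.toLp 2 y)) +
    (d ⬝ᵥ (gram k X Z)ᵀ *ᵥ r - r ⬝ᵥ r) / (2 * σ ^ 2)))
  congr 1 with u
  set w : Fin m → ℝ := fun j => u j - μ (Z j) with hw
  -- In the coordinate `v = K_ZZ⁻¹ (u - μ_Z)` the prior exponent is `-vᵀ K_ZZ v / 2`, the training
  -- mean is `μ_X + K_XZ v`, and `u - m* = K_ZZ (v - d)`.
  set v := (gram k Z Z)⁻¹ *ᵥ w with hv
  have hKv : gram k Z Z *ᵥ v = w := by rw [hv, mulVec_mulVec, mul_nonsing_inv _ hK, one_mulVec]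
  have hsq := complete_square (v := v) hσ2 hMG hMT hMd
  have e1 : (u - WithLp.toLp 2 fun j => μ (Z j)).ofLp = w := rfl
  have e2 : (u - inducingPosteriorMean μ k Z σ X y).ofLp = gram k Z Z *ᵥ (v - d) := by
    rw [mulVec_sub, hKv]
    ext j
    simp only [inducingPosteriorMean, PiLp.sub_apply, Pi.add_apply, Pi.sub_apply, hw, hd, hMdef, hr]
    ring
  have e3 : ∀ i, y i - condMean μ k Z X u i = (r - gram k X Z *ᵥ v) i := fun i => by
    simp only [condMean, Pi.sub_apply, hr, hv, hw, mulVec, kvec, gram, of_apply, dotProduct]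
    ring
  have e4 : (inducingPosteriorCov k Z σ X)⁻¹ *ᵥ (gram k Z Z *ᵥ (v - d)) =
      (σ ^ 2)⁻¹ • ((gram k Z Z)⁻¹ *ᵥ (M *ᵥ (v - d))) := by
    have : (inducingPosteriorCov k Z σ X)⁻¹ =
        (σ ^ 2)⁻¹ • ((gram k Z Z)⁻¹ * (M * (gram k Z Z)⁻¹)) := by
      refine inv_eq_left_inv ?_
      rw [inducingPosteriorCov, smul_mul_smul_comm, inv_mul_cancel₀ hσ2, one_smul,
        Matrix.mul_assoc (gram k Z Z)⁻¹, Matrix.mul_assoc M, Matrix.mul_assoc (gram k Z Z) M⁻¹,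
        ← Matrix.mul_assoc (gram k Z Z)⁻¹ (gram k Z Z), nonsing_inv_mul _ hK, Matrix.one_mul,
        ← Matrix.mul_assoc M, mul_nonsing_inv _ hM, Matrix.one_mul, nonsing_inv_mul _ hK]
    rw [this, smul_mulVec, ← mulVec_mulVec, ← mulVec_mulVec, mulVec_mulVec _ _ (gram k Z Z),
      nonsing_inv_mul _ hK, one_mulVec]
  have e5 : (gram k Z Z *ᵥ (v - d)) ⬝ᵥ ((gram k Z Z)⁻¹ *ᵥ (M *ᵥ (v - d))) =
      (v - d) ⬝ᵥ M *ᵥ (v - d) := by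
    rw [← vecMul_transpose, transpose_gram hk, ← dotProduct_mulVec, mulVec_mulVec _ (gram k Z Z),
      mul_nonsing_inv _ hK, one_mulVec]
  rw [Pi.add_apply, log_likelihood hσ, e1, e2, e4, dotProduct_smul, e5, smul_eq_mul]
  have e6 : ∑ i, (y i - condMean μ k Z X u i) ^ 2 =
      (r - gram k X Z *ᵥ v) ⬝ᵥ (r - gram k X Z *ᵥ v) := by
    simp_rw [e3, dotProduct, sq]
  rw [e6, ← hv]
  have e7 : w ⬝ᵥ v = v ⬝ᵥ gram k Z Z *ᵥ v := by rw [hKv, dotProduct_comm]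
  rw [e7]
  linarith

/-! ### The evidence lower bound and its maximizers. -/

instance isProbabilityMeasure_inducingPrior (μ : 𝒳 → ℝ) (k : 𝒳 → 𝒳 → ℝ) (Z : Fin m → 𝒳) :
    IsProbabilityMeasure (inducingPrior μ k Z) := by
  unfold inducingPrior
  infer_instance

lemma integrable_likelihood_condMean {σ : ℝ} (hσ : 0 < σ) (μ : 𝒳 → ℝ) (k : 𝒳 → 𝒳 → ℝ)
    (Z : Fin m → 𝒳) (X : Fin n → 𝒳) (y : Fin n → ℝ) (p : Measure (EuclideanSpace ℝ (Fin m)))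
    [IsFiniteMeasure p] : Integrable (fun u => likelihood σ y (condMean μ k Z X u)) p := by
  refine Integrable.of_bound
    ((measurable_likelihood σ y).comp (measurable_condMean μ k Z X)).aestronglyMeasurable
    (likelihood σ y (WithLp.toLp 2 y)) (ae_of_all _ fun u => ?_)
  rw [Real.norm_of_nonneg (likelihood_pos hσ y _).le, ← Real.log_le_log_iff
    (likelihood_pos hσ y _) (likelihood_pos hσ y _), log_likelihood hσ]
  have : 0 ≤ (∑ i, (y i - condMean μ k Z X u i) ^ 2) / (2 * σ ^ 2) := by positivity
  linarith

lemma memLp_condMean (μ : 𝒳 → ℝ) (k : 𝒳 → 𝒳 → ℝ) (Z : Fin m → 𝒳) (X : Fin n → 𝒳)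
    (a : EuclideanSpace ℝ (Fin m)) (S : Matrix (Fin m) (Fin m) ℝ) (i : Fin n) :
    MemLp (fun u => condMean μ k Z X u i) 2 (multivariateGaussian a S) := by
  have h1 : MemLp (fun u : EuclideanSpace ℝ (Fin m) => u) 2 (multivariateGaussian a S) :=
    IsGaussian.memLp_two_id
  have h2 := ((EuclideanSpace.proj (𝕜 := ℝ) i).comp (LinearMap.toContinuousLinearMap
    (toEuclideanLin (gram k X Z * (gram k Z Z)⁻¹)))).comp_memLp' h1
  refine ((memLp_const (condMean μ k Z X 0 i)).add h2).ae_eq (ae_of_all _ fun u => ?_)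
  exact (congrArg (fun x : EuclideanSpace ℝ (Fin n) => x i) (condMean_eq μ k Z X u)).symm

lemma integrable_log_likelihood_condMean {σ : ℝ} (hσ : 0 < σ) (μ : 𝒳 → ℝ) (k : 𝒳 → 𝒳 → ℝ)
    (Z : Fin m → 𝒳) (X : Fin n → 𝒳) (y : Fin n → ℝ)
    (a : EuclideanSpace ℝ (Fin m)) (S : Matrix (Fin m) (Fin m) ℝ) :
    Integrable (fun u => Real.log (likelihood σ y (condMean μ k Z X u)))
      (multivariateGaussian a S) := by
  simp_rw [log_likelihood hσ y (condMean μ k Z X _)]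
  refine (integrable_const _).sub (Integrable.div_const (integrable_finsetSum _ fun i _ => ?_) _)
  exact ((memLp_const (y i)).sub (memLp_condMean μ k Z X a S i)).integrable_sq

/-- The conditional covariance of the training values only shifts the expected log-likelihood by
a constant that does not depend on the variational parameters. -/
lemma integral_log_likelihood_svgpPosterior {σ : ℝ} (hσ : 0 < σ) (μ : 𝒳 → ℝ) (k : 𝒳 → 𝒳 → ℝ)
    (Z : Fin m → 𝒳) (X : Fin n → 𝒳) (y : Fin n → ℝ) :
    ∃ c : ℝ, ∀ (a : EuclideanSpace ℝ (Fin m)) (S : Matrix (Fin m) (Fin m) ℝ),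
      ∫ f, Real.log (likelihood σ y f) ∂(svgpPosterior μ k Z a S X) =
        ∫ u, Real.log (likelihood σ y (condMean μ k Z X u)) ∂(multivariateGaussian a S) + c := by
  set ν := multivariateGaussian (0 : EuclideanSpace ℝ (Fin n))
    (gram k X X - gram (lowRank k Z) X X) with hν
  have hνid : MemLp (fun w : EuclideanSpace ℝ (Fin n) => w) 2 ν := IsGaussian.memLp_two_id
  have hν2 : ∀ i, MemLp (fun w : EuclideanSpace ℝ (Fin n) => w i) 2 ν := fun i =>
    (EuclideanSpace.proj (𝕜 := ℝ) i).comp_memLp' hνid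
  have hν0 : ∀ i, ∫ w : EuclideanSpace ℝ (Fin n), w i ∂ν = 0 := fun i => by
    have := (EuclideanSpace.proj (𝕜 := ℝ) i).integral_comp_comm
      (hνid.integrable (by norm_num))
    rw [hν, integral_id_multivariateGaussian] at this
    simpa using this
  -- The constant is the expected quadratic penalty of the conditional noise alone.
  refine ⟨∫ w : EuclideanSpace ℝ (Fin n), -((∑ i, w i ^ 2) / (2 * σ ^ 2)) ∂ν, fun a S => ?_⟩
  set q := multivariateGaussian a S with hq
  have hsq : Integrable (fun w : EuclideanSpace ℝ (Fin n) => -((∑ i, w i ^ 2) / (2 * σ ^ 2))) ν :=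
    ((integrable_finsetSum _ fun i _ => (hν2 i).integrable_sq).div_const _).neg
  have hg := integrable_log_likelihood_condMean hσ μ k Z X y a S
  have hlin : ∀ i, Integrable (fun u => (y i - condMean μ k Z X u i) / σ ^ 2) q := fun i =>
    (((integrable_const (y i)).sub
      ((memLp_condMean μ k Z X a S i).integrable (by norm_num))).div_const _)
  have hcross : ∀ i, Integrable (fun z : EuclideanSpace ℝ (Fin m) × EuclideanSpace ℝ (Fin n) =>
      (y i - condMean μ k Z X z.1 i) / σ ^ 2 * z.2 i) (q.prod ν) := fun i =>
    (hlin i).mul_prod ((hν2 i).integrable (by norm_num))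
  -- The cross term is a sum of products of independent factors, one of them centred, so it
  -- integrates to zero.
  have hexpand : ∀ z : EuclideanSpace ℝ (Fin m) × EuclideanSpace ℝ (Fin n),
      Real.log (likelihood σ y (condMean μ k Z X z.1 + z.2)) =
        Real.log (likelihood σ y (condMean μ k Z X z.1)) +
          ∑ i, (y i - condMean μ k Z X z.1 i) / σ ^ 2 * z.2 i +
            -((∑ i, z.2 i ^ 2) / (2 * σ ^ 2)) := fun z => by
    rw [log_likelihood hσ, log_likelihood hσ y (condMean μ k Z X z.1), add_assoc, sub_add,
      sub_right_inj, Finset.sum_div, Finset.sum_div, Finset.sum_div, ← sub_eq_add_neg,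
      ← Finset.sum_sub_distrib, ← Finset.sum_sub_distrib]
    refine Finset.sum_congr rfl fun i _ => ?_
    rw [PiLp.add_apply]
    field_simp
    ring
  have hm := measurable_condMean μ k Z X
  have hl := (measurable_likelihood σ y).log
  have hcrossSum : Integrable (fun z : EuclideanSpace ℝ (Fin m) × EuclideanSpace ℝ (Fin n) =>
      ∑ i, (y i - condMean μ k Z X z.1 i) / σ ^ 2 * z.2 i) (q.prod ν) :=
    integrable_finsetSum _ fun i _ => hcross i
  have hfst : Integrable (fun z : EuclideanSpace ℝ (Fin m) × EuclideanSpace ℝ (Fin n) =>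
      Real.log (likelihood σ y (condMean μ k Z X z.1)) +
        ∑ i, (y i - condMean μ k Z X z.1 i) / σ ^ 2 * z.2 i) (q.prod ν) :=
    (hg.comp_fst ν).add hcrossSum
  rw [svgpPosterior, bind_eq_map_prod μ k Z X q (ν := ν) (exactCond_apply_eq_map μ k Z X),
    integral_map (by fun_prop) hl.aestronglyMeasurable, integral_congr_ae (ae_of_all _ hexpand),
    integral_add hfst (hsq.comp_snd q), integral_add (hg.comp_fst ν) hcrossSum,
    integral_finsetSum _ fun i _ => hcross i,
    integral_fun_fst fun u => Real.log (likelihood σ y (condMean μ k Z X u)),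
    integral_fun_snd fun w : EuclideanSpace ℝ (Fin n) => -((∑ i, w i ^ 2) / (2 * σ ^ 2))]
  have h0 : ∀ i, ∫ z : EuclideanSpace ℝ (Fin m) × EuclideanSpace ℝ (Fin n),
      (y i - condMean μ k Z X z.1 i) / σ ^ 2 * z.2 i ∂(q.prod ν) = 0 := fun i => by
    rw [integral_prod_mul (fun u => (y i - condMean μ k Z X u i) / σ ^ 2)
      (fun w : EuclideanSpace ℝ (Fin n) => w i), hν0, mul_zero]
  rw [Finset.sum_eq_zero fun i _ => h0 i]
  simp [hq]

/-- The evidence lower bound is, up to a constant, minus the divergence from the exact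
conditional law of the inducing variables. -/
lemma elbo_eq_sub_klDiv {k : 𝒳 → 𝒳 → ℝ} (hk : (Matrix.of k).PosSemidef)
    {X : Fin n → 𝒳} {Z : Fin m → 𝒳} (hrank : (gram k X Z).rank = m) {σ : ℝ} (hσ : 0 < σ)
    (μ : 𝒳 → ℝ) (y : Fin n → ℝ) :
    ∃ c : ℝ, ∀ (a : EuclideanSpace ℝ (Fin m)) (S : Matrix (Fin m) (Fin m) ℝ),
      elbo μ k Z σ X y a S = (c : EReal) - ((InformationTheory.klDiv (multivariateGaussian a S)
        (multivariateGaussian (inducingPosteriorMean μ k Z σ X y)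
          (inducingPosteriorCov k Z σ X)) : ℝ≥0∞) : EReal) := by
  obtain ⟨c, hc⟩ := integral_log_likelihood_svgpPosterior hσ μ k Z X y
  -- The log evidence of the model with deterministic training conditional, shifted by the noise
  -- constant.
  refine ⟨Real.log (∫ u, Real.exp (Real.log (likelihood σ y (condMean μ k Z X u)))
    ∂(inducingPrior μ k Z)) + c, fun a S => ?_⟩
  rw [elbo, hc, ← inducingPrior_tilted hk hrank hσ μ y, coe_integral_sub_klDiv_eq _ _
    (integrable_log_likelihood_condMean hσ μ k Z X y a S)]
  refine (integrable_likelihood_condMean hσ μ k Z X y _).congr (ae_of_all _ fun u => ?_)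
  exact (Real.exp_log (likelihood_pos hσ y _)).symm

/-- `𝒩(m*, S*)` is itself admissible with zero divergence, so a maximizer must have zero divergence
too. Equality of laws is enough to determine the posterior; `S` itself need not be identified. -/
lemma isSVGPOptimal_iff {k : 𝒳 → 𝒳 → ℝ} (hk : (Matrix.of k).PosSemidef)
    {X : Fin n → 𝒳} {Z : Fin m → 𝒳} (hrank : (gram k X Z).rank = m) {σ : ℝ} (hσ : 0 < σ)
    (μ : 𝒳 → ℝ) (y : Fin n → ℝ) (a : EuclideanSpace ℝ (Fin m)) (S : Matrix (Fin m) (Fin m) ℝ) :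
    IsSVGPOptimal μ k Z σ X y a S ↔ S.PosSemidef ∧ multivariateGaussian a S =
      multivariateGaussian (inducingPosteriorMean μ k Z σ X y) (inducingPosteriorCov k Z σ X) := by
  obtain ⟨c, hc⟩ := elbo_eq_sub_klDiv hk hrank hσ μ y
  refine and_congr_right fun _ => ⟨fun h => ?_, fun h a' S' _ => ?_⟩
  · have h1 := h (inducingPosteriorMean μ k Z σ X y) _
      (posDef_inducingPosteriorCov hk hrank hσ).posSemidef
    rw [hc, hc, InformationTheory.klDiv_self, EReal.coe_ennreal_zero, sub_zero] at h1
    rw [← InformationTheory.klDiv_eq_zero_iff]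
    generalize InformationTheory.klDiv _ _ = d at h1 ⊢
    induction d with
    | top => simp at h1
    | coe d =>
      have h2 : (c : EReal) ≤ ((c - (d : ℝ) : ℝ) : EReal) := h1
      rw [EReal.coe_le_coe_iff] at h2
      have h3 : (d : ℝ) ≤ 0 := by linarith
      simpa using NNReal.coe_eq_zero.1 (le_antisymm h3 d.2)
  · rw [hc, hc, h, InformationTheory.klDiv_self]
    exact EReal.sub_le_sub le_rfl (EReal.coe_ennreal_nonneg _)

end SparseGP

end

theorem mainTheorem10 {𝒳 : Type*} {m n : ℕ}
    (μ : 𝒳 → ℝ) (k : 𝒳 → 𝒳 → ℝ) (hk : (Matrix.of k).PosSemidef)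
    (X : Fin n → 𝒳) (y : Fin n → ℝ) (σ : ℝ) (hσ : 0 < σ)
    (Z : Fin m → 𝒳) (hrank : (SparseGP.gram k X Z).rank = m) :
    -- the matrices that the two formulas invert are invertible
    (IsUnit (SparseGP.gram k Z Z) ∧
      IsUnit (SparseGP.gram k Z X * SparseGP.gram k X Z + σ ^ 2 • SparseGP.gram k Z Z) ∧
      IsUnit (SparseGP.gram k Z X *
        (SparseGP.gram (SparseGP.lowRank k Z) X X + σ ^ 2 • (1 : Matrix (Fin n) (Fin n) ℝ)) *
        SparseGP.gram k X Z)) ∧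
    -- SoR and DTC
    (∀ (t : ℕ) (A : Fin t → 𝒳),
      SparseGP.HasMean (SparseGP.sorPosterior μ k Z σ X y A)
        (fun i => SparseGP.inducingMean μ k Z σ X y (A i))) ∧
    (∀ (t : ℕ) (A : Fin t → 𝒳),
      SparseGP.HasMean (SparseGP.dtcPosterior μ k Z σ X y A)
        (fun i => SparseGP.inducingMean μ k Z σ X y (A i))) ∧
    -- SVGP: optimal variational parameters exist, and each of them yields this posterior mean
    (∃ (a : EuclideanSpace ℝ (Fin m)) (S : Matrix (Fin m) (Fin m) ℝ),
      S.PosDef ∧ SparseGP.IsSVGPOptimal μ k Z σ X y a S) ∧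
    (∀ (a : EuclideanSpace ℝ (Fin m)) (S : Matrix (Fin m) (Fin m) ℝ),
      SparseGP.IsSVGPOptimal μ k Z σ X y a S →
      ∀ (t : ℕ) (A : Fin t → 𝒳),
        SparseGP.HasMean (SparseGP.svgpPosterior μ k Z a S A)
          (fun i => SparseGP.inducingMean μ k Z σ X y (A i))) ∧
    -- the second form of the posterior mean
    (∀ x : 𝒳, SparseGP.inducingMean μ k Z σ X y x =
      μ x + SparseGP.kvec (SparseGP.lowRank k Z) x X ⬝ᵥ
        (SparseGP.gram k X Z *ᵥ
          ((SparseGP.gram k Z X *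
            (SparseGP.gram (SparseGP.lowRank k Z) X X +
              σ ^ 2 • (1 : Matrix (Fin n) (Fin n) ℝ)) *
            SparseGP.gram k X Z)⁻¹ *ᵥ
            (SparseGP.gram k Z X *ᵥ fun i => y i - μ (X i))))) := by
  have hint := SparseGP.integrable_likelihood_condMean hσ μ k Z X y
    (SparseGP.inducingPrior μ k Z)
  have hK := SparseGP.posDef_gram hk hrank
  have hM := SparseGP.posDef_precision hk hrank hσ
  have hT := SparseGP.posDef_gram_mul_gram hk hrank
  have hmean : ∀ (t : ℕ) (A : Fin t → 𝒳),
      (SparseGP.condMean μ k Z A (SparseGP.inducingPosteriorMean μ k Z σ X y)).ofLp =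
        fun i => SparseGP.inducingMean μ k Z σ X y (A i) := fun t A => funext
    (SparseGP.condMean_inducingPosteriorMean hk hrank σ μ y A)
  refine ⟨⟨hK.isUnit, hM.isUnit, ?_⟩, fun t A => ?_, fun t A => ?_,
    ⟨SparseGP.inducingPosteriorMean μ k Z σ X y, SparseGP.inducingPosteriorCov k Z σ X,
      SparseGP.posDef_inducingPosteriorCov hk hrank hσ,
      (SparseGP.isSVGPOptimal_iff hk hrank hσ μ y _ _).2
        ⟨(SparseGP.posDef_inducingPosteriorCov hk hrank hσ).posSemidef, rfl⟩⟩,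
    fun a S h t A => ?_, SparseGP.inducingMean_eq_lowRank hk hrank μ y⟩
  · rw [SparseGP.gram_mul_lowRank_mul_gram hk hrank]
    exact (hM.isUnit.mul hK.inv.isUnit).mul hT.isUnit
  · rw [SparseGP.sorPosterior, SparseGP.posterior_jointPrior_detCond μ k Z hσ X y _ hint,
      SparseGP.inducingPrior_tilted hk hrank hσ, ← hmean]
    exact SparseGP.hasMean_bind_detCond μ k Z A _ _
  · rw [SparseGP.dtcPosterior, SparseGP.posterior_jointPrior_detCond μ k Z hσ X y _ hint,
      SparseGP.inducingPrior_tilted hk hrank hσ, ← hmean]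
    exact SparseGP.hasMean_svgpPosterior μ k Z A _ _
  · have h' := ((SparseGP.isSVGPOptimal_iff hk hrank hσ μ y a S).1 h).2
    rw [SparseGP.svgpPosterior, h', ← hmean]
    exact SparseGP.hasMean_svgpPosterior μ k Z A _ _
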